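/- Let $I,m\in\mathbb{N}$. For $i=1,\dots,I$ let $\mathcal{C}_i(d,e)=\{x_i\in\mathbb{R}^{K_i}: D_ix_i\le d_i,\ E_ix_i=e_i\}$ with fixed real matrices $D_i,E_i$ and right-hand sides $d=(d_i)_i$, $e=(e_i)_i$, and let $\mathcal{C}(d,e)=\prod_i\mathcal{C}_i(d,e)$. Let $A$ be a real matrix with $m$ rows and $\sum_i K_i$ columns. For $p=(b,c,d,e)$ consider the linear program $$\min_x\ c^Tx\quad\text{subject to}\quad Ax\le b,\qquad x_i\in\mathcal{C}_i(d,e)\ \ (i=1,\dots,I).$$ For $x\in\mathcal{C}(d,e)$ let $\mu_i$, the corral dimension of $x_i$, be one less than the least number of vertices of $\mathcal{C}_i(d,e)$ whose convex hull contains $x_i$, and let $\mu(x)=\frac1I\sum_i\mu_i$ be the mean corral dimension. Fix $(b^0,c^0,d^0,e^0)$ such that every $\mathcal{C}_i(d^0,e^0)$ is a polytope (non-empty and bounded), fix $\epsilon_b,\epsilon_c,\epsilon_d,\epsilon_e>0$, and let $\mathcal{B}=B_{\epsilon_b}(b^0)\times B_{\epsilon_c}(c^0)\times B_{\epsilon_d}(d^0)\times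 B_{\epsilon_e}(e^0)$ be the product of the open Euclidean balls. Then, with respect to Lebesgue measure: (1) For almost every $p\in\mathcal{B}$: if the linear program is feasible, then its optimal solution $x^*(p)$ exists and is unique, and $\mu(x^*(p))\le m/I$. (2) For almost every $(p,\lambda)\in\mathcal{B}\times\mathbb{R}^m$, and also, for each fixed $\lambda\in\mathbb{R}^m$, for almost every $p\in\mathcal{B}$: if $\mathcal{C}(d,e)\neq\emptyset$, then the minimizer $x_0^*(p,\lambda)$ of $(c+A^T\lambda)^Tx$ over $x\in\mathcal{C}(d,e)$ exists and is unique, each of its blocks is a vertex of the corresponding $\mathcal{C}_i(d,e)$, and hence $\mu(x_0^*(p,\lambda))=0$. -/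

import Mathlib

open MeasureTheory
open scoped Matrix

/-- The parameter space of `p = (b, c, d, e)`. There are `I` blocks; block `i` has `K i` variables,
`R i` inequality rows and `S i` equality rows; there are `m` coupling constraints. -/
abbrev Param {I : ℕ} (m : ℕ) (K R S : Fin I → ℕ) : Type :=
  EuclideanSpace ℝ (Fin m) × EuclideanSpace ℝ (Σ i, Fin (K i)) ×
    EuclideanSpace ℝ (Σ i, Fin (R i)) × EuclideanSpace ℝ (Σ i, Fin (S i))

/-- The product of the open Euclidean balls of radii `εb, εc, εd, εe` around `b, c, d, e`. -/
def paramBox {I m : ℕ} {K R S : Fin I → ℕ} (p₀ : Param m K R S) (εb εc εd εe : ℝ) :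
    Set (Param m K R S) :=
  Metric.ball p₀.1 εb ×ˢ Metric.ball p₀.2.1 εc ×ˢ Metric.ball p₀.2.2.1 εd ×ˢ
    Metric.ball p₀.2.2.2 εe

/-- The block `x_i` of a vector `x`. -/
def block {I : ℕ} {K : Fin I → ℕ} (x : (Σ i, Fin (K i)) → ℝ) (i : Fin I) : Fin (K i) → ℝ :=
  fun k => x ⟨i, k⟩

section Problem

variable {I m : ℕ} {K R S : Fin I → ℕ}
  (A : Matrix (Fin m) (Σ i, Fin (K i)) ℝ)
  (D : ∀ i, Matrix (Fin (R i)) (Fin (K i)) ℝ)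
  (E : ∀ i, Matrix (Fin (S i)) (Fin (K i)) ℝ)

/-- The block set `C_i = {y | D_i y ≤ d_i, E_i y = e_i}`. -/
def blockSet (p : Param m K R S) (i : Fin I) : Set (Fin (K i) → ℝ) :=
  {y | (∀ r, (D i *ᵥ y) r ≤ p.2.2.1 ⟨i, r⟩) ∧ ∀ s, (E i *ᵥ y) s = p.2.2.2 ⟨i, s⟩}

/-- The product `C` of the block sets. -/
def prodSet (p : Param m K R S) : Set ((Σ i, Fin (K i)) → ℝ) :=
  {x | ∀ i, block x i ∈ blockSet D E p i}

/-- The feasible set of the linear program: `A x ≤ b` and `x_i ∈ C_i` for all `i`. -/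
def feasibleSet (p : Param m K R S) : Set ((Σ i, Fin (K i)) → ℝ) :=
  {x | (∀ j, (A *ᵥ x) j ≤ p.1 j) ∧ x ∈ prodSet D E p}

/-- The set of minimizers of the linear function `x ↦ wᵀ x` over `P`. -/
def linMinimizers {ι : Type} [Fintype ι] (w : ι → ℝ) (P : Set (ι → ℝ)) : Set (ι → ℝ) :=
  {x | x ∈ P ∧ ∀ y ∈ P, w ⬝ᵥ x ≤ w ⬝ᵥ y}

/-- The optimal solutions of: minimize `cᵀ x` subject to `A x ≤ b`, `x_i ∈ C_i`. -/
def lpSolutions (p : Param m K R S) : Set ((Σ i, Fin (K i)) → ℝ) :=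
  linMinimizers (fun j => p.2.1 j) (feasibleSet A D E p)

/-- The minimizers of `(c + Aᵀ l)ᵀ x` over `C`. -/
def dualMinimizers (p : Param m K R S) (l : EuclideanSpace ℝ (Fin m)) :
    Set ((Σ i, Fin (K i)) → ℝ) :=
  linMinimizers (fun j => p.2.1 j + (Aᵀ *ᵥ (fun k => l k)) j) (prodSet D E p)

/-- The corral dimension of a point `y` of a polytope `C`: one less than the least number of
vertices of `C` whose convex hull contains `y`. -/
noncomputable def corralDim {n : ℕ} (C : Set (Fin n → ℝ)) (y : Fin n → ℝ) : ℕ :=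
  sInf {k | ∃ U : Finset (Fin n → ℝ), (U : Set (Fin n → ℝ)) ⊆ C.extremePoints ℝ ∧
    y ∈ convexHull ℝ (U : Set (Fin n → ℝ)) ∧ U.card = k + 1}

/-- The mean corral dimension `(∑ i, μ_i) / I`. -/
noncomputable def meanCorralDim (p : Param m K R S) (x : (Σ i, Fin (K i)) → ℝ) : ℝ :=
  (∑ i, (corralDim (blockSet D E p i) (block x i) : ℝ)) / I

end Problem

/-! The recession cone depends on `D` and `E` but not on the right-hand sides, so boundedness at
`p₀` makes every nonempty feasible set compact, and minimizers exist. There are finitely many sets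
of constraints; for each one with a nonzero common kernel, the objectives vanishing on that kernel
form a null set. Hence almost every objective is `GenericFor` the arrangement. At a minimizer one
can move both ways along the common kernel of the tight constraints, so the objective vanishes there
and genericity forces this kernel to be zero. Applied to the midpoint of two minimizers, this gives
uniqueness (`exists_unique_minimizer`). With coupling rows, the zero kernel makes `A` injective on
the product of the block face directions, whose dimensions therefore sum to at most `m`
(`sum_finrank_blockFaceDir_le`). Carathéodory within each face (`exists_finset_extremePoints`)
bounds the corral dimension by the face dimension. Without coupling rows every face is a vertex. -/

section Polyhedron

/-! ### Polyhedra: recession, generic minimizers, minimal faces. -/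

variable {W α β : Type*} [NormedAddCommGroup W] [NormedSpace ℝ W]

/-- The polyhedron `{x | f a x ≤ u a, g b x = v b}`. -/
def polyhedron (f : α → W →ₗ[ℝ] ℝ) (g : β → W →ₗ[ℝ] ℝ) (u : α → ℝ) (v : β → ℝ) : Set W :=
  {x | (∀ a, f a x ≤ u a) ∧ ∀ b, g b x = v b}

/-- The common kernel of the inequality functionals in `J` and of all equality functionals. -/
def activeKer (f : α → W →ₗ[ℝ] ℝ) (g : β → W →ₗ[ℝ] ℝ) (J : Set α) : Submodule ℝ W where
  carrier := {z | (∀ a ∈ J, f a z = 0) ∧ ∀ b, g b z = 0}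
  zero_mem' := by simp
  add_mem' := by
    rintro x y ⟨hx, hx'⟩ ⟨hy, hy'⟩
    exact ⟨fun a ha => by simp [hx a ha, hy a ha], fun b => by simp [hx' b, hy' b]⟩
  smul_mem' := by
    rintro t x ⟨hx, hx'⟩
    exact ⟨fun a ha => by simp [hx a ha], fun b => by simp [hx' b]⟩

/-- The set of inequalities that are tight at `x`. -/
def activeSet (f : α → W →ₗ[ℝ] ℝ) (u : α → ℝ) (x : W) : Set α := {a | f a x = u a}

/-- Only the zero vector is a direction in which the polyhedra given by `f` and `g` recede. -/
def TrivialRecession (f : α → W →ₗ[ℝ] ℝ) (g : β → W →ₗ[ℝ] ℝ) : Prop :=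
  ∀ z, (∀ a, f a z ≤ 0) → (∀ b, g b z = 0) → z = 0

variable {f : α → W →ₗ[ℝ] ℝ} {g : β → W →ₗ[ℝ] ℝ} {u : α → ℝ} {v : β → ℝ}

lemma trivialRecession_of_isBounded (hne : (polyhedron f g u v).Nonempty)
    (hb : Bornology.IsBounded (polyhedron f g u v)) : TrivialRecession f g := by
  intro z hf hg
  obtain ⟨x, hx⟩ := hne
  obtain ⟨B, hB⟩ := isBounded_iff_forall_norm_le.1 hb
  have key : ∀ t : ℝ, 0 ≤ t → t * ‖z‖ ≤ B + ‖x‖ := by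
    intro t ht
    have hmem : x + t • z ∈ polyhedron f g u v := by
      refine ⟨fun a => ?_, fun b => ?_⟩
      · have := hx.1 a
        have := mul_nonpos_of_nonneg_of_nonpos ht (hf a)
        simp only [map_add, map_smul, smul_eq_mul]
        linarith
      · simp [hg b, hx.2 b]
    have h1 := hB _ hmem
    have h2 : ‖t • z‖ ≤ ‖x + t • z‖ + ‖x‖ := by
      simpa using norm_sub_le (x + t • z) x
    rw [norm_smul, Real.norm_of_nonneg ht] at h2
    linarith
  by_contra hz
  have hz' : 0 < ‖z‖ := norm_pos_iff.2 hz
  have hB0 : 0 ≤ B + ‖x‖ := by simpa using key 0 le_rfl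
  have := key ((B + ‖x‖ + 1) / ‖z‖) (by positivity)
  rw [div_mul_cancel₀ _ hz'.ne'] at this
  linarith

/-- A functional generic for the arrangement `f`, `g`: it vanishes on no nonzero face direction
space. -/
def GenericFor (f : α → W →ₗ[ℝ] ℝ) (g : β → W →ₗ[ℝ] ℝ) (w : W →ₗ[ℝ] ℝ) : Prop :=
  ∀ J : Set α, activeKer f g J ≠ ⊥ → ∃ z ∈ activeKer f g J, w z ≠ 0

/-- Tight inequalities do not change along `z`, and the finitely many slack ones survive a small
step by continuity. -/
lemma exists_pos_add_sub_mem [Finite α] {x z : W} (hx : x ∈ polyhedron f g u v)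
    (hz : z ∈ activeKer f g (activeSet f u x)) :
    ∃ t : ℝ, 0 < t ∧ x + t • z ∈ polyhedron f g u v ∧ x - t • z ∈ polyhedron f g u v := by
  have h : ∀ a, ∀ᶠ t : ℝ in nhdsWithin 0 (Set.Ioi 0),
      f a x + t * f a z ≤ u a ∧ f a x - t * f a z ≤ u a := by
    intro a
    rcases (hx.1 a).eq_or_lt with ha | ha
    · have := hz.1 a ha
      simp [this, ha]
    · have h1 : Filter.Tendsto (fun t : ℝ => f a x + t * f a z) (nhds 0) (nhds (f a x)) :=
        Continuous.tendsto' (by fun_prop) _ _ (by simp)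
      have h2 : Filter.Tendsto (fun t : ℝ => f a x - t * f a z) (nhds 0) (nhds (f a x)) :=
        Continuous.tendsto' (by fun_prop) _ _ (by simp)
      exact ((h1.eventually_le_const ha).and (h2.eventually_le_const ha)).filter_mono
        nhdsWithin_le_nhds
  obtain ⟨t, ht, ht0⟩ := ((Filter.eventually_all.2 h).and self_mem_nhdsWithin).exists
  refine ⟨t, ht0, ⟨fun a => ?_, fun b => ?_⟩, ⟨fun a => ?_, fun b => ?_⟩⟩
  · simpa using (ht a).1
  · simp [hz.2 b, hx.2 b]
  · simpa using (ht a).2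
  · simp [hz.2 b, hx.2 b]

/-- A tight inequality at a proper convex combination is tight at both ends. -/
lemma sub_mem_activeKer {x y₁ y₂ : W} (h₁ : y₁ ∈ polyhedron f g u v)
    (h₂ : y₂ ∈ polyhedron f g u v) (hx : x ∈ openSegment ℝ y₁ y₂) :
    y₁ - y₂ ∈ activeKer f g (activeSet f u x) := by
  obtain ⟨s, t, hs, ht, hst, rfl⟩ := hx
  refine ⟨fun a ha => ?_, fun b => by simp [h₁.2 b, h₂.2 b]⟩
  have ha' : s * f a y₁ + t * f a y₂ = u a := by simpa [activeSet] using ha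
  have e : s * (u a - f a y₁) + t * (u a - f a y₂) = 0 := by
    linear_combination u a * hst - ha'
  have p₁ := mul_nonneg hs.le (sub_nonneg.2 (h₁.1 a))
  have p₂ := mul_nonneg ht.le (sub_nonneg.2 (h₂.1 a))
  have q₁ : u a - f a y₁ = 0 :=
    (mul_eq_zero.1 (by linarith : s * (u a - f a y₁) = 0)).resolve_left hs.ne'
  have q₂ : u a - f a y₂ = 0 :=
    (mul_eq_zero.1 (by linarith : t * (u a - f a y₂) = 0)).resolve_left ht.ne'
  rw [map_sub]
  linarith

lemma mem_extremePoints_of_activeKer_eq_bot {x : W} (hx : x ∈ polyhedron f g u v)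
    (h : activeKer f g (activeSet f u x) = ⊥) : x ∈ (polyhedron f g u v).extremePoints ℝ := by
  refine ⟨hx, fun y₁ h₁ y₂ h₂ hxy => ?_⟩
  have h12 := sub_mem_activeKer h₁ h₂ hxy
  rw [h, Submodule.mem_bot, sub_eq_zero] at h12
  subst h12
  rw [openSegment_same] at hxy
  exact (Set.mem_singleton_iff.1 hxy).symm

/-- A nonempty compact polyhedron has exactly one minimizer of a generic functional, and the tight
constraints there determine the point. -/
lemma exists_unique_minimizer [FiniteDimensional ℝ W] [Finite α] {w : W →ₗ[ℝ] ℝ}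
    (hne : (polyhedron f g u v).Nonempty) (hc : IsCompact (polyhedron f g u v))
    (hw : GenericFor f g w) :
    ∃ x, {x | x ∈ polyhedron f g u v ∧ ∀ y ∈ polyhedron f g u v, w x ≤ w y} = {x} ∧
      x ∈ polyhedron f g u v ∧ activeKer f g (activeSet f u x) = ⊥ := by
  have hker : ∀ x ∈ polyhedron f g u v, (∀ y ∈ polyhedron f g u v, w x ≤ w y) →
      activeKer f g (activeSet f u x) = ⊥ := by
    intro x hx hmin
    by_contra hbot
    obtain ⟨z, hz, hwz⟩ := hw _ hbot
    obtain ⟨t, ht, h₁, h₂⟩ := exists_pos_add_sub_mem hx hz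
    have e₁ := hmin _ h₁
    have e₂ := hmin _ h₂
    simp only [map_add, map_sub, map_smul, smul_eq_mul] at e₁ e₂
    have : t * w z = 0 := by linarith
    exact (mul_ne_zero ht.ne' hwz) this
  obtain ⟨x, hx, hmin⟩ := hc.exists_isMinOn hne w.continuous_of_finiteDimensional.continuousOn
  have hmin' : ∀ y ∈ polyhedron f g u v, w x ≤ w y := fun y hy => hmin hy
  refine ⟨x, ?_, hx, hker x hx hmin'⟩
  ext y
  refine ⟨?_, ?_⟩
  · rintro ⟨hy, hymin⟩
    have hxy : w x = w y := le_antisymm (hmin' y hy) (hymin x hx)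
    let q : W := (1 / 2 : ℝ) • x + (1 / 2 : ℝ) • y
    have hq : q ∈ polyhedron f g u v := by
      refine ⟨fun a => ?_, fun b => ?_⟩
      · have := hx.1 a
        have := hy.1 a
        simp only [q, map_add, map_smul, smul_eq_mul]
        linarith
      · simp only [q, map_add, map_smul, smul_eq_mul, hx.2 b, hy.2 b]
        ring
    have hqs : q ∈ openSegment ℝ x y := ⟨1 / 2, 1 / 2, by norm_num, by norm_num, by norm_num, rfl⟩
    have hwq : w q = w x := by
      simp only [q, map_add, map_smul, smul_eq_mul, ← hxy]
      ring
    have h := sub_mem_activeKer hx hy hqs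
    -- The midpoint `q` is itself a minimizer, so its tight constraints have zero kernel; that
    -- kernel contains `x - y`.
    rw [hker q hq (fun y hy => hwq ▸ hmin' y hy), Submodule.mem_bot, sub_eq_zero] at h
    exact h.symm
  · rintro rfl
    exact ⟨hx, hmin'⟩

lemma isClosed_polyhedron [FiniteDimensional ℝ W] : IsClosed (polyhedron f g u v) := by
  have : polyhedron f g u v = (⋂ a, {x | f a x ≤ u a}) ∩ ⋂ b, {x | g b x = v b} := by
    ext; simp [polyhedron]
  rw [this]
  exact (isClosed_iInter fun a => isClosed_le (f a).continuous_of_finiteDimensional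
    continuous_const).inter (isClosed_iInter fun b =>
      isClosed_eq (g b).continuous_of_finiteDimensional continuous_const)

/-- The function `φ` measures how far a direction is from receding. It is positively homogeneous
and, by compactness of the sphere, at least `δ * ‖x‖`, while the right-hand sides bound it on the
polyhedron. -/
lemma isBounded_polyhedron [FiniteDimensional ℝ W] [Fintype α] [Fintype β]
    (h : TrivialRecession f g) : Bornology.IsBounded (polyhedron f g u v) := by
  let φ : W → ℝ := fun z => ∑ a, max (f a z) 0 + ∑ b, |g b z|
  have hφc : Continuous φ := by
    have hf := fun a => (f a).continuous_of_finiteDimensional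
    have hg := fun b => (g b).continuous_of_finiteDimensional
    fun_prop
  have hφ0 : ∀ z, 0 ≤ φ z := fun z => by positivity
  have hφpos : ∀ z, z ≠ 0 → 0 < φ z := by
    intro z hz
    refine (hφ0 z).lt_of_ne fun h0 => hz (h z (fun a => ?_) fun b => ?_)
    all_goals
      have hs₁ : 0 ≤ ∑ a, max (f a z) 0 := by positivity
      have hs₂ : 0 ≤ ∑ b, |g b z| := by positivity
      have h0' : ∑ a, max (f a z) 0 + ∑ b, |g b z| = 0 := h0.symm
    · have := (Finset.sum_eq_zero_iff_of_nonneg fun a _ => le_max_right (f a z) 0).1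
        (by linarith) a (Finset.mem_univ a)
      exact (le_max_left _ _).trans this.le
    · have := (Finset.sum_eq_zero_iff_of_nonneg fun b _ => abs_nonneg (g b z)).1
        (by linarith) b (Finset.mem_univ b)
      exact abs_eq_zero.1 this
  have hφhom : ∀ (t : ℝ) (z : W), 0 ≤ t → φ (t • z) = t * φ z := by
    intro t z ht
    simp only [φ, map_smul, smul_eq_mul, abs_mul, abs_of_nonneg ht, mul_add, Finset.mul_sum,
      mul_max_of_nonneg _ _ ht, mul_zero]
  obtain ⟨δ, hδ, hδφ⟩ : ∃ δ > 0, ∀ z ∈ Metric.sphere (0 : W) 1, δ ≤ φ z := by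
    rcases (Metric.sphere (0 : W) 1).eq_empty_or_nonempty with he | hne
    · exact ⟨1, one_pos, by simp [he]⟩
    · have : ProperSpace W := FiniteDimensional.proper ℝ W
      obtain ⟨z, hz, hmin⟩ := (isCompact_sphere (0 : W) 1).exists_isMinOn hne hφc.continuousOn
      refine ⟨φ z, hφpos z ?_, fun y hy => hmin hy⟩
      rintro rfl
      simp at hz
  refine isBounded_iff_forall_norm_le.2 ⟨(∑ a, max (u a) 0 + ∑ b, |v b|) / δ, fun x hx => ?_⟩
  have hle : φ x ≤ ∑ a, max (u a) 0 + ∑ b, |v b| := by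
    refine add_le_add (Finset.sum_le_sum fun a _ => max_le_max (hx.1 a) le_rfl)
      (Finset.sum_le_sum fun b _ => ?_)
    rw [hx.2 b]
  rw [le_div_iff₀ hδ]
  refine le_trans ?_ hle
  rcases eq_or_ne x 0 with rfl | hx0
  · simpa using hφ0 0
  · have hn : 0 < ‖x‖ := norm_pos_iff.2 hx0
    have h1 := hδφ (‖x‖⁻¹ • x) (by simp [norm_smul, hn.ne'])
    rw [hφhom _ _ (by positivity), inv_mul_eq_div, le_div_iff₀ hn] at h1
    linarith

/-- Moving from a point of the polyhedron along a nonzero direction of its minimal face, one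
reaches a point where more inequalities are tight. -/
lemma exists_exit [Finite α] (h : TrivialRecession f g) {x z : W}
    (hx : x ∈ polyhedron f g u v) (hz : z ∈ activeKer f g (activeSet f u x)) (hz0 : z ≠ 0) :
    ∃ t : ℝ, 0 < t ∧ x + t • z ∈ polyhedron f g u v ∧
      activeSet f u x ⊆ activeSet f u (x + t • z) ∧
      ∃ a ∈ activeSet f u (x + t • z), f a z ≠ 0 := by
  have hex : {a | 0 < f a z}.Nonempty := by
    by_contra hne
    rw [Set.not_nonempty_iff_eq_empty] at hne
    refine hz0 (h z (fun a => not_lt.1 fun ha => ?_) hz.2)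
    have : a ∈ {a | 0 < f a z} := ha
    simp [hne] at this
  -- Ratio test: the smallest ratio is the time at which the ray first hits an inequality.
  obtain ⟨a, ha, hmin⟩ := Set.exists_min_image {a | 0 < f a z} (fun a => (u a - f a x) / f a z)
    (Set.toFinite _) hex
  have ha' : 0 < f a z := ha
  refine ⟨(u a - f a x) / f a z, div_pos ?_ ha', ⟨fun c => ?_, fun b => ?_⟩, fun c hc => ?_,
    a, ?_, ha'.ne'⟩
  · exact sub_pos.2 ((hx.1 a).lt_of_ne fun he => ha'.ne' (hz.1 a he))
  · rw [map_add, map_smul, smul_eq_mul]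
    rcases le_or_gt (f c z) 0 with hc | hc
    · have h0 : 0 ≤ (u a - f a x) / f a z := div_nonneg (sub_nonneg.2 (hx.1 a)) ha'.le
      have := mul_nonpos_of_nonneg_of_nonpos h0 hc
      linarith [hx.1 c]
    · have := (le_div_iff₀ hc).1 (hmin c hc)
      linarith
  · simp [hz.2 b, hx.2 b]
  · have h1 : f c x = u c := hc
    simp [activeSet, hz.1 c hc, h1]
  · simp [activeSet, ha'.ne']

/-- Carathéodory's theorem inside the minimal face of a point of a polytope. -/
lemma exists_finset_extremePoints [FiniteDimensional ℝ W] [Finite α] (h : TrivialRecession f g)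
    {x : W} (hx : x ∈ polyhedron f g u v) :
    ∃ U : Finset W, (U : Set W) ⊆ (polyhedron f g u v).extremePoints ℝ ∧
      (∀ y ∈ U, activeSet f u x ⊆ activeSet f u y) ∧ x ∈ convexHull ℝ (U : Set W) ∧
      U.card ≤ Module.finrank ℝ (activeKer f g (activeSet f u x)) + 1 := by
  classical
  induction hn : Module.finrank ℝ (activeKer f g (activeSet f u x)) using Nat.strong_induction_on
    generalizing x with
  | _ n ih =>
  by_cases hbot : activeKer f g (activeSet f u x) = ⊥
  · exact ⟨{x}, by simpa using mem_extremePoints_of_activeKer_eq_bot hx hbot, by simp, by simp,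
      by simp⟩
  have step : ∀ z ∈ activeKer f g (activeSet f u x), z ≠ 0 →
      ∃ t : ℝ, 0 < t ∧ ¬ activeSet f u (x + t • z) ⊆ activeSet f u x ∧ ∃ U : Finset W,
        (U : Set W) ⊆ (polyhedron f g u v).extremePoints ℝ ∧
        (∀ y ∈ U, activeSet f u (x + t • z) ⊆ activeSet f u y) ∧
        activeSet f u x ⊆ activeSet f u (x + t • z) ∧
        x + t • z ∈ convexHull ℝ (U : Set W) ∧ U.card ≤ n := by
    intro z hz hz0
    obtain ⟨t, ht, hmem, hsub, a, ha, haz⟩ := exists_exit h hx hz hz0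
    have hlt : activeKer f g (activeSet f u (x + t • z)) < activeKer f g (activeSet f u x) := by
      refine lt_of_le_of_ne (fun y hy => ⟨fun c hc => hy.1 c (hsub hc), hy.2⟩) fun he => ?_
      rw [← he] at hz
      exact haz (hz.1 a ha)
    have hfr := Submodule.finrank_lt_finrank_of_lt hlt
    obtain ⟨U, h₁, h₂, h₃, h₄⟩ := ih _ (hn ▸ hfr) hmem rfl
    exact ⟨t, ht, fun hs => haz (hz.1 a (hs ha)), U, h₁, h₂, hsub, h₃, by omega⟩
  obtain ⟨z, hz, hz0⟩ := (Submodule.ne_bot_iff _).1 hbot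
  -- This first exit only serves to find a vertex `y` of the minimal face of `x`. A second exit,
  -- from `x` away from `y`, reaches a smaller face needing at most `n` vertices; adding `y` gives
  -- `n + 1`.
  obtain ⟨t, -, hns, U, hU, hUa, hsub, hxU, -⟩ := step z hz hz0
  obtain ⟨y, hy⟩ : U.Nonempty := by
    simpa using convexHull_nonempty_iff.1 ⟨_, hxU⟩
  have hxy : x - y ≠ 0 := by
    intro he
    rw [sub_eq_zero] at he
    -- The vertex `y` satisfies with equality an inequality that is slack at `x`.
    exact hns (he ▸ hUa y hy)
  have hdir : x - y ∈ activeKer f g (activeSet f u x) := by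
    refine ⟨fun a ha => ?_, fun b => ?_⟩
    · have h1 : f a x = u a := ha
      have h2 : f a y = u a := hUa y hy (hsub ha)
      simp [h1, h2]
    · have := (hU hy).1.2 b
      simp [this, hx.2 b]
  obtain ⟨s, hs, -, U', hU', hUa', hsub', hxU', hcard⟩ := step _ hdir hxy
  refine ⟨insert y U', ?_, ?_, ?_, (Finset.card_insert_le _ _).trans (by omega)⟩
  · rw [Finset.coe_insert]
    exact Set.insert_subset (hU hy) hU'
  · intro q hq
    rcases Finset.mem_insert.1 hq with rfl | hq
    · exact hsub.trans (hUa _ hy)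
    · exact hsub'.trans (hUa' q hq)
  · rw [Finset.coe_insert]
    have m₁ : y ∈ convexHull ℝ (insert y (U' : Set W)) := subset_convexHull ℝ _ (by simp)
    have m₂ : x + s • (x - y) ∈ convexHull ℝ (insert y (U' : Set W)) :=
      convexHull_mono (Set.subset_insert _ _) hxU'
    have hs1 : (1 + s) ≠ 0 := by positivity
    have hcomb : x = (s / (1 + s)) • y + (1 / (1 + s)) • (x + s • (x - y)) := by
      match_scalars
      all_goals
        field_simp
        try ring
    rw [hcomb]
    exact convex_convexHull ℝ _ m₁ m₂ (by positivity) (by positivity) (by field_simp; ring)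

end Polyhedron

lemma corralDim_le_finrank_activeKer {n : ℕ} {α β : Type*} [Finite α]
    {f : α → (Fin n → ℝ) →ₗ[ℝ] ℝ} {g : β → (Fin n → ℝ) →ₗ[ℝ] ℝ} {u : α → ℝ} {v : β → ℝ}
    (h : TrivialRecession f g) {x : Fin n → ℝ} (hx : x ∈ polyhedron f g u v) :
    corralDim (polyhedron f g u v) x ≤ Module.finrank ℝ (activeKer f g (activeSet f u x)) := by
  obtain ⟨U, hU, -, hxU, hcard⟩ := exists_finset_extremePoints h hx
  -- Nonemptiness makes the truncated subtraction `U.card - 1` exact.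
  have hne : U.Nonempty := by
    simpa using convexHull_nonempty_iff.1 ⟨_, hxU⟩
  have hpos := hne.card_pos
  have : corralDim (polyhedron f g u v) x ≤ U.card - 1 :=
    Nat.sInf_le ⟨U, hU, hxU, by omega⟩
  omega

/-! ### Almost every objective is generic. -/

lemma isAddHaarMeasure_volume_prod {G H : Type*} [NormedAddCommGroup G] [MeasureSpace G]
    [BorelSpace G] [NormedAddCommGroup H] [MeasureSpace H] [BorelSpace H]
    [SigmaCompactSpace G] [SigmaCompactSpace H]
    [(volume : Measure G).IsAddHaarMeasure] [(volume : Measure H).IsAddHaarMeasure] :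
    (volume : Measure (G × H)).IsAddHaarMeasure :=
  Measure.prod.instIsAddHaarMeasure volume volume

/-- A nonzero linear functional almost surely avoids a given value. -/
lemma ae_linearMap_ne {V : Type*} [NormedAddCommGroup V] [NormedSpace ℝ V] [FiniteDimensional ℝ V]
    [MeasurableSpace V] [BorelSpace V] (μ : Measure V) [μ.IsAddHaarMeasure]
    (φ : V →ₗ[ℝ] ℝ) (hφ : φ ≠ 0) (k : ℝ) : ∀ᵐ p ∂μ, φ p ≠ k := by
  obtain ⟨q, hq⟩ := LinearMap.surjective hφ k
  have h0 : μ (LinearMap.ker φ : Set V) = 0 :=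
    Measure.addHaar_submodule μ _ fun h => hφ (LinearMap.ker_eq_top.1 h)
  have h1 : μ ((fun p => p + -q) ⁻¹' (LinearMap.ker φ : Set V)) = 0 := by
    rw [measure_preimage_add_right, h0]
  rw [ae_iff]
  refine measure_mono_null (fun p hp => ?_) h1
  have hp' : φ p = k := not_not.1 hp
  simp [hp', hq]

/-- One nonzero `z` per nonzero kernel suffices: the bad parameters for it lie on an affine
hyperplane, and there are finitely many `J`. The shift `w₀` accommodates a fixed multiplier. -/
lemma ae_genericFor {W α β V : Type*} [NormedAddCommGroup W] [NormedSpace ℝ W] [Finite α]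
    [NormedAddCommGroup V] [NormedSpace ℝ V] [FiniteDimensional ℝ V]
    [MeasurableSpace V] [BorelSpace V] {μ : Measure V} (hμ : μ.IsAddHaarMeasure)
    (f : α → W →ₗ[ℝ] ℝ) (g : β → W →ₗ[ℝ] ℝ) (Φ : V →ₗ[ℝ] W →ₗ[ℝ] ℝ) (w₀ : W →ₗ[ℝ] ℝ)
    (hΦ : ∀ z, z ≠ 0 → Φ.flip z ≠ 0) : ∀ᵐ p ∂μ, GenericFor f g (Φ p + w₀) := by
  refine ae_all_iff.2 fun J => ?_
  by_cases hJ : activeKer f g J = ⊥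
  · exact Filter.Eventually.of_forall fun p h => absurd hJ h
  · obtain ⟨z, hz, hz0⟩ := (Submodule.ne_bot_iff _).1 hJ
    filter_upwards [ae_linearMap_ne μ (Φ.flip z) (hΦ z hz0) (-(w₀ z))] with p hp _
    refine ⟨z, hz, fun h => hp ?_⟩
    have h' : Φ p z + w₀ z = 0 := by simpa using h
    rw [LinearMap.flip_apply]
    linarith

/-! ### Block structure and dimension count. -/

section Blocks

variable {I m : ℕ} {K R S : Fin I → ℕ}

/-- Restriction of a vector to its block `i`, as a linear map. -/
def blockLin (K : Fin I → ℕ) (i : Fin I) : ((Σ i, Fin (K i)) → ℝ) →ₗ[ℝ] Fin (K i) → ℝ :=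
  LinearMap.funLeft ℝ ℝ fun k => ⟨i, k⟩

/-- The rows of a family of matrices acting on the blocks. -/
def blockRow (D : ∀ i, Matrix (Fin (R i)) (Fin (K i)) ℝ) (i : Fin I) (r : Fin (R i)) :
    (Fin (K i) → ℝ) →ₗ[ℝ] ℝ :=
  LinearMap.proj r ∘ₗ (D i).mulVecLin

/-- The rows of a family of matrices acting on the full vector. -/
def prodRow (D : ∀ i, Matrix (Fin (R i)) (Fin (K i)) ℝ) (a : Σ i, Fin (R i)) :
    ((Σ i, Fin (K i)) → ℝ) →ₗ[ℝ] ℝ :=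
  blockRow D a.1 a.2 ∘ₗ blockLin K a.1

/-- The rows of the coupling matrix followed by the rows of the blocks. -/
def coupledRow (A : Matrix (Fin m) (Σ i, Fin (K i)) ℝ)
    (D : ∀ i, Matrix (Fin (R i)) (Fin (K i)) ℝ) :
    Fin m ⊕ (Σ i, Fin (R i)) → ((Σ i, Fin (K i)) → ℝ) →ₗ[ℝ] ℝ :=
  Sum.elim (fun j => LinearMap.proj j ∘ₗ A.mulVecLin) (prodRow D)

/-- The right-hand sides matching `coupledRow`. -/
def coupledBound (p : Param m K R S) : Fin m ⊕ (Σ i, Fin (R i)) → ℝ :=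
  Sum.elim (fun j => p.1 j) (fun a => p.2.2.1 a)

/-- The functional `x ↦ wᵀ x`. -/
abbrev dotLin {ι : Type*} [Fintype ι] : (ι → ℝ) →ₗ[ℝ] (ι → ℝ) →ₗ[ℝ] ℝ := dotProductBilin ℝ ℝ

variable (A : Matrix (Fin m) (Σ i, Fin (K i)) ℝ)
  (D : ∀ i, Matrix (Fin (R i)) (Fin (K i)) ℝ)
  (E : ∀ i, Matrix (Fin (S i)) (Fin (K i)) ℝ)

lemma prodSet_eq_polyhedron (p : Param m K R S) :
    prodSet D E p = polyhedron (prodRow D) (prodRow E) (fun a => p.2.2.1 a)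
      (fun b => p.2.2.2 b) := by
  ext x
  exact ⟨fun h => ⟨fun a => (h a.1).1 a.2, fun b => (h b.1).2 b.2⟩,
    fun h i => ⟨fun r => h.1 ⟨i, r⟩, fun s => h.2 ⟨i, s⟩⟩⟩

lemma feasibleSet_eq_polyhedron (p : Param m K R S) :
    feasibleSet A D E p = polyhedron (coupledRow A D) (prodRow E) (coupledBound p)
      (fun b => p.2.2.2 b) := by
  ext x
  simp only [feasibleSet, prodSet_eq_polyhedron, polyhedron, Set.mem_ofPred_eq, Sum.forall,
    ← and_assoc]
  rfl

variable {A D E}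

lemma trivialRecession_prodRow (h : ∀ i, TrivialRecession (blockRow D i) (blockRow E i)) :
    TrivialRecession (prodRow D) (prodRow E) := by
  intro z hf hg
  ext ⟨i, k⟩
  exact congrFun (h i (blockLin K i z) (fun r => hf ⟨i, r⟩) fun s => hg ⟨i, s⟩) k

lemma isCompact_prodSet (h : ∀ i, TrivialRecession (blockRow D i) (blockRow E i))
    (p : Param m K R S) : IsCompact (prodSet D E p) := by
  rw [prodSet_eq_polyhedron]
  exact Metric.isCompact_of_isClosed_isBounded isClosed_polyhedron
    (isBounded_polyhedron (trivialRecession_prodRow h))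

lemma isCompact_feasibleSet (h : ∀ i, TrivialRecession (blockRow D i) (blockRow E i))
    (p : Param m K R S) : IsCompact (feasibleSet A D E p) := by
  refine Metric.isCompact_of_isClosed_isBounded ?_
    ((isCompact_prodSet h p).isBounded.subset fun x hx => hx.2)
  rw [feasibleSet_eq_polyhedron]
  exact isClosed_polyhedron

/-- The directions of the minimal face of block `i` at `x`. -/
noncomputable def blockFaceDir (D : ∀ i, Matrix (Fin (R i)) (Fin (K i)) ℝ)
    (E : ∀ i, Matrix (Fin (S i)) (Fin (K i)) ℝ) (p : Param m K R S)
    (x : (Σ i, Fin (K i)) → ℝ) (i : Fin I) : Submodule ℝ (Fin (K i) → ℝ) :=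
  activeKer (blockRow D i) (blockRow E i)
    (activeSet (blockRow D i) (fun r => p.2.2.1 ⟨i, r⟩) (block x i))

lemma corralDim_block_le (h : ∀ i, TrivialRecession (blockRow D i) (blockRow E i))
    {p : Param m K R S} {x : (Σ i, Fin (K i)) → ℝ} (hx : x ∈ prodSet D E p) (i : Fin I) :
    corralDim (blockSet D E p i) (block x i) ≤ Module.finrank ℝ (blockFaceDir D E p x i) :=
  corralDim_le_finrank_activeKer (h i) (hx i)

/-- Assembling a vector from its blocks. -/
noncomputable def glue (V : ∀ i, Submodule ℝ (Fin (K i) → ℝ)) :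
    (∀ i, V i) →ₗ[ℝ] (Σ i, Fin (K i)) → ℝ where
  toFun z s := (z s.1 : Fin (K s.1) → ℝ) s.2
  map_add' _ _ := rfl
  map_smul' _ _ := rfl

lemma glue_mem_activeKer {p : Param m K R S} {x : (Σ i, Fin (K i)) → ℝ}
    (z : ∀ i, blockFaceDir D E p x i) :
    glue _ z ∈ activeKer (prodRow D) (prodRow E)
      (activeSet (prodRow D) (fun a => p.2.2.1 a) x) :=
  ⟨fun a ha => (z a.1).2.1 a.2 ha, fun b => (z b.1).2.2 b.2⟩

lemma glue_eq_zero {V : ∀ i, Submodule ℝ (Fin (K i) → ℝ)} {z : ∀ i, V i} (h : glue V z = 0) :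
    z = 0 := by
  ext i k
  exact congrFun h ⟨i, k⟩

/-- If the tight constraints determine `x`, then the minimal faces of its blocks have total
dimension at most the number of coupling constraints. -/
lemma sum_finrank_blockFaceDir_le {p : Param m K R S} {x : (Σ i, Fin (K i)) → ℝ}
    (h : activeKer (coupledRow A D) (prodRow E)
      (activeSet (coupledRow A D) (coupledBound p) x) = ⊥) :
    ∑ i, Module.finrank ℝ (blockFaceDir D E p x i) ≤ m := by
  -- Glued face directions already annihilate the tight block rows; if `A` kills them too, they lie
  -- in the zero kernel.
  have hinj : Function.Injective (A.mulVecLin ∘ₗ glue (blockFaceDir D E p x)) := by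
    rw [← LinearMap.ker_eq_bot, LinearMap.ker_eq_bot']
    intro z hz
    apply glue_eq_zero
    rw [← Submodule.mem_bot ℝ, ← h]
    have hmem := glue_mem_activeKer z
    refine ⟨?_, hmem.2⟩
    rintro (j | a) ha
    · exact congrFun hz j
    · exact hmem.1 a ha
  simpa [Module.finrank_pi_fintype] using LinearMap.finrank_le_finrank_of_injective hinj

/-- For a generic objective, the optimal solution of a feasible coupled program is unique and has
mean corral dimension at most `m / I`. -/
lemma exists_lpSolutions_eq_singleton
    (h : ∀ i, TrivialRecession (blockRow D i) (blockRow E i)) {p : Param m K R S}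
    (hc : GenericFor (coupledRow A D) (prodRow E) (dotLin fun j => p.2.1 j))
    (hne : (feasibleSet A D E p).Nonempty) :
    ∃ x, lpSolutions A D E p = {x} ∧ meanCorralDim D E p x ≤ (m : ℝ) / I := by
  have hcpt := isCompact_feasibleSet (A := A) h p
  have hP := feasibleSet_eq_polyhedron A D E p
  rw [hP] at hne hcpt
  obtain ⟨x, hx, hmem, hbot⟩ := exists_unique_minimizer hne hcpt hc
  refine ⟨x, ?_, ?_⟩
  · rw [lpSolutions, hP]
    exact hx
  · rw [← hP] at hmem
    have hle : ∑ i, corralDim (blockSet D E p i) (block x i) ≤ m :=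
      (Finset.sum_le_sum fun i _ => corralDim_block_le h hmem.2 i).trans
        (sum_finrank_blockFaceDir_le hbot)
    refine div_le_div_of_nonneg_right ?_ (Nat.cast_nonneg I)
    exact_mod_cast hle

/-- For a generic objective, the minimizer over the product of the blocks is unique and consists
of vertices. -/
lemma exists_linMinimizers_prodSet_eq_singleton
    (h : ∀ i, TrivialRecession (blockRow D i) (blockRow E i)) {p : Param m K R S}
    {w : (Σ i, Fin (K i)) → ℝ} (hw : GenericFor (prodRow D) (prodRow E) (dotLin w))
    (hne : (prodSet D E p).Nonempty) :
    ∃ x, linMinimizers w (prodSet D E p) = {x} ∧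
      (∀ i, block x i ∈ (blockSet D E p i).extremePoints ℝ) ∧ meanCorralDim D E p x = 0 := by
  have hcpt := isCompact_prodSet h p
  have hP := prodSet_eq_polyhedron D E p
  rw [hP] at hne hcpt
  obtain ⟨x, hx, hmem, hbot⟩ := exists_unique_minimizer hne hcpt hw
  rw [← hP] at hmem
  have hface : ∀ i, blockFaceDir D E p x i = ⊥ := by
    refine fun i => (Submodule.eq_bot_iff _).2 fun z hz => ?_
    have h0 := glue_mem_activeKer (D := D) (E := E) (p := p) (x := x) (Pi.single i ⟨z, hz⟩)
    rw [hbot, Submodule.mem_bot] at h0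
    simpa using congrArg Subtype.val (congrFun (glue_eq_zero h0) i)
  refine ⟨x, ?_, fun i => mem_extremePoints_of_activeKer_eq_bot (hmem i) (hface i), ?_⟩
  · rw [hP]
    exact hx
  · have h0 : ∀ i, corralDim (blockSet D E p i) (block x i) = 0 := fun i => by
      have := corralDim_block_le h hmem i
      rw [hface i, finrank_bot] at this
      omega
    simp [meanCorralDim, h0]

/-- The objective `c` as a linear function of the parameter. -/
def costLin (m : ℕ) (K R S : Fin I → ℕ) : Param m K R S →ₗ[ℝ] (Σ i, Fin (K i)) → ℝ :=
  (WithLp.linearEquiv 2 ℝ ((Σ i, Fin (K i)) → ℝ)).toLinearMap ∘ₗ LinearMap.fst ℝ _ _ ∘ₗ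
    LinearMap.snd ℝ _ _

lemma exists_costLin_dotProduct_ne_zero {z : (Σ i, Fin (K i)) → ℝ} (hz : z ≠ 0) :
    ∃ p : Param m K R S, costLin m K R S p ⬝ᵥ z ≠ 0 :=
  ⟨(0, WithLp.toLp 2 z, 0, 0), fun h => hz (dotProduct_self_eq_zero.1 h)⟩

end Blocks

theorem theorem1 {I m : ℕ} {K R S : Fin I → ℕ}
    (A : Matrix (Fin m) (Σ i, Fin (K i)) ℝ)
    (D : ∀ i, Matrix (Fin (R i)) (Fin (K i)) ℝ)
    (E : ∀ i, Matrix (Fin (S i)) (Fin (K i)) ℝ)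
    (p₀ : Param m K R S)
    (hne : ∀ i, (blockSet D E p₀ i).Nonempty)
    (hbd : ∀ i, Bornology.IsBounded (blockSet D E p₀ i))
    (εb εc εd εe : ℝ) (hεb : 0 < εb) (hεc : 0 < εc) (hεd : 0 < εd) (hεe : 0 < εe) :
    (∀ᵐ p ∂(volume.restrict (paramBox p₀ εb εc εd εe)),
      (feasibleSet A D E p).Nonempty →
        ∃ x, lpSolutions A D E p = {x} ∧ meanCorralDim D E p x ≤ (m : ℝ) / I) ∧
    (∀ᵐ q ∂((volume : Measure (Param m K R S × EuclideanSpace ℝ (Fin m))).restrict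
        (paramBox p₀ εb εc εd εe ×ˢ Set.univ)),
      (prodSet D E q.1).Nonempty →
        ∃ x, dualMinimizers A D E q.1 q.2 = {x} ∧
          (∀ i, block x i ∈ (blockSet D E q.1 i).extremePoints ℝ) ∧
          meanCorralDim D E q.1 x = 0) ∧
    (∀ l : EuclideanSpace ℝ (Fin m), ∀ᵐ p ∂(volume.restrict (paramBox p₀ εb εc εd εe)),
      (prodSet D E p).Nonempty →
        ∃ x, dualMinimizers A D E p l = {x} ∧
          (∀ i, block x i ∈ (blockSet D E p i).extremePoints ℝ) ∧
          meanCorralDim D E p x = 0) := by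
  have h : ∀ i, TrivialRecession (blockRow D i) (blockRow E i) := fun i =>
    trivialRecession_of_isBounded (hne i) (hbd i)
  have hcost : ∀ z, z ≠ 0 → (dotLin ∘ₗ costLin m K R S).flip z ≠ 0 := by
    intro z hz h0
    obtain ⟨p, hp⟩ := exists_costLin_dotProduct_ne_zero (m := m) (R := R) (S := S) hz
    exact hp (LinearMap.congr_fun h0 p)
  have hvol : (volume : Measure (Param m K R S)).IsAddHaarMeasure :=
    have := isAddHaarMeasure_volume_prod (G := EuclideanSpace ℝ (Σ i, Fin (R i)))
      (H := EuclideanSpace ℝ (Σ i, Fin (S i)))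
    have := isAddHaarMeasure_volume_prod (G := EuclideanSpace ℝ (Σ i, Fin (K i)))
      (H := EuclideanSpace ℝ (Σ i, Fin (R i)) × EuclideanSpace ℝ (Σ i, Fin (S i)))
    isAddHaarMeasure_volume_prod
  -- Each claim holds almost everywhere on the whole parameter space, since `h` no longer refers to
  -- `p₀`.
  refine ⟨ae_restrict_of_ae ?_, ae_restrict_of_ae ?_, fun l => ae_restrict_of_ae ?_⟩
  · filter_upwards [ae_genericFor hvol (coupledRow A D) (prodRow E)
      (dotLin ∘ₗ costLin m K R S) 0 hcost] with p hp
    rw [add_zero] at hp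
    exact exists_lpSolutions_eq_singleton h hp
  -- The objective `c + Aᵀ l` is jointly linear in the parameter and the multiplier; varying `c`
  -- with `l = 0` already shows nondegeneracy.
  · let L : (Param m K R S × EuclideanSpace ℝ (Fin m)) →ₗ[ℝ] (Σ i, Fin (K i)) → ℝ :=
      costLin m K R S ∘ₗ LinearMap.fst ℝ _ _ +
        Aᵀ.mulVecLin ∘ₗ (WithLp.linearEquiv 2 ℝ (Fin m → ℝ)).toLinearMap ∘ₗ LinearMap.snd ℝ _ _
    have hL : ∀ z, z ≠ 0 → (dotLin ∘ₗ L).flip z ≠ 0 := by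
      intro z hz h0
      obtain ⟨p, hp⟩ := exists_costLin_dotProduct_ne_zero (m := m) (R := R) (S := S) hz
      have h1 : L (p, 0) ⬝ᵥ z = 0 := LinearMap.congr_fun h0 (p, 0)
      exact hp (by simpa [L] using h1)
    filter_upwards [ae_genericFor isAddHaarMeasure_volume_prod (prodRow D) (prodRow E)
      (dotLin ∘ₗ L) 0 hL] with q hq
    rw [add_zero] at hq
    exact exists_linMinimizers_prodSet_eq_singleton h hq
  · filter_upwards [ae_genericFor hvol (prodRow D) (prodRow E) (dotLin ∘ₗ costLin m K R S)
      (dotLin (Aᵀ *ᵥ fun k => l k)) hcost] with p hp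
    rw [LinearMap.comp_apply, ← map_add] at hp
    exact exists_linMinimizers_prodSet_eq_singleton h hp
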